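/- Let $\Gamma\subset\mathbb{C}$ be a lattice, i.e. a discrete additive subgroup of rank $2$. For a lattice $G\subset\mathbb{C}$ put $g_2(G)=\sum_{u\in G\setminus\{0\}}60\,u^{-4}$, $g_3(G)=\sum_{u\in G\setminus\{0\}}140\,u^{-6}$ and $\Delta(G)=g_2(G)^3-27g_3(G)^2$. Every subgroup of index $2$ in a lattice is again a lattice; a subgroup $\Gamma'$ of index $2$ in a lattice $\Gamma$ is called optimal in $\Gamma$ if $|\Delta(\Gamma')|\le|\Delta(G)|$ for all subgroups $G\subset\Gamma$ of index $2$. If $\Gamma'$ is an optimal subgroup of index $2$ in $\Gamma$, then $\Gamma'$ has exactly one optimal subgroup of index $2$. -/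

import Mathlib

noncomputable section

/-- A lattice in `ℂ`: a discrete additive subgroup of rank exactly `2`. -/
def IsComplexLattice (Γ : AddSubgroup ℂ) : Prop :=
  DiscreteTopology Γ ∧ Module.finrank ℤ Γ = 2

/-- The Weierstrass invariant `g₂(Γ)`, the sum of `60 / u ^ 4` over the nonzero `u ∈ Γ`.
The sum converges absolutely when `Γ` is discrete. -/
def weierstrassG2 (Γ : AddSubgroup ℂ) : ℂ :=
  ∑' u : {u : ℂ // u ∈ Γ ∧ u ≠ 0}, 60 / (u : ℂ) ^ 4

/-- The Weierstrass invariant `g₃(Γ)`, the sum of `140 / u ^ 6` over the nonzero `u ∈ Γ`.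
The sum converges absolutely when `Γ` is discrete. -/
def weierstrassG3 (Γ : AddSubgroup ℂ) : ℂ :=
  ∑' u : {u : ℂ // u ∈ Γ ∧ u ≠ 0}, 140 / (u : ℂ) ^ 6

/-- The discriminant `Δ(Γ) = g₂(Γ)³ - 27 g₃(Γ)²`. -/
def weierstrassDelta (Γ : AddSubgroup ℂ) : ℂ :=
  weierstrassG2 Γ ^ 3 - 27 * weierstrassG3 Γ ^ 2

/-- `IsIndexTwoSubgroup Γ G`: `G` is a subgroup of `Γ` and `[Γ : G] = 2`. -/
def IsIndexTwoSubgroup (Γ G : AddSubgroup ℂ) : Prop :=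
  G ≤ Γ ∧ G.relIndex Γ = 2

/-- `IsOptimalIndexTwo Γ Γ'`: `Γ'` is an optimal subgroup of index `2` in `Γ`, that is,
`|Δ(Γ')|` is smallest among all subgroups of index `2` in `Γ`. -/
def IsOptimalIndexTwo (Γ Γ' : AddSubgroup ℂ) : Prop :=
  IsIndexTwoSubgroup Γ Γ' ∧
    ∀ G : AddSubgroup ℂ, IsIndexTwoSubgroup Γ G →
      ‖weierstrassDelta Γ'‖ ≤ ‖weierstrassDelta G‖

end

open Filter Topology PeriodPair

/-! ### Weierstrass `℘`: its differential equations and values at half periods. -/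

namespace PeriodPair
variable (L : PeriodPair)

/-! Subgroups of index 2 in a lattice Λ are 2Λ ∪ (2w + 2Λ) for the half periods w, hence correspond
to the three distinct roots ℘(w) of 4X³ - g₂X - g₃ (`IsComplexLattice.exists_bijOn_roots`). Taylor
coefficients of ℘' at w express g₂ and g₃ of the subgroup through the root. If it belongs to the
root a, and b, c are the others, its Δ is (b-c)³ times (a-b)(a-c)(b-c)/16, whose modulus is
symmetric in the roots (`norm_weierstrassDelta_eq`). So optimal means that b, c are a closest pair.

Let Γ' be optimal, with root x, and y, z the others. Put P² = x-y, Q² = x-z. The cubic of Γ' has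
roots (x+2PQ)/4, (x-2PQ)/4, -x/2, with differences PQ, (P+Q)²/4, (P-Q)²/4. Choose the sign of Q so
that |P-Q| ≤ |P+Q|. Optimality says |P-Q||P+Q| = |y-z| ≤ |P|², |Q|². This makes |P-Q|²/4 strictly
the smallest distance, so the closest pair, and with it the optimal subgroup of Γ', is unique. -/

lemma isOpen_compl_lattice : IsOpen (L.lattice : Set ℂ)ᶜ :=
  L.isClosed_lattice.isOpen_compl

lemma isPreconnected_compl_lattice : IsPreconnected (L.lattice : Set ℂ)ᶜ :=
  (Set.Countable.isConnected_compl_of_one_lt_rank (by simp)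
    (Set.countable_coe_iff.mp (inferInstanceAs (Countable L.lattice)))).2

lemma eventually_notMem_lattice (x : ℂ) : ∀ᶠ z in 𝓝[≠] x, z ∉ L.lattice := by
  filter_upwards [nhdsWithin_le_nhds (L.compl_lattice_sdiff_singleton_mem_nhds x),
    self_mem_nhdsWithin] with z hz hz' h
  exact hz ⟨h, hz'⟩

lemma not_tendsto_nhds_weierstrassP {l : ℂ} (hl : l ∈ L.lattice) (c : ℂ) :
    ¬ Tendsto ℘[L] (𝓝[≠] l) (𝓝 c) := by
  intro h
  have h' : Tendsto ℘[L] (𝓝[≠] l) (Bornology.cobounded ℂ) :=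
    tendsto_cobounded_of_meromorphicOrderAt_neg (by rw [L.order_weierstrassP l hl]; decide)
  exact not_tendsto_nhds_of_tendsto_atTop (tendsto_norm_cobounded_atTop.comp h') _ h.norm

lemma hasDerivAt_weierstrassP {z : ℂ} (hz : z ∉ L.lattice) : HasDerivAt ℘[L] (℘'[L] z) z := by
  rw [← L.deriv_weierstrassP]
  exact (L.analyticOnNhd_weierstrassP z hz).differentiableAt.hasDerivAt

lemma exists_derivWeierstrassP_ne_zero : ∃ z ∉ L.lattice, ℘'[L] z ≠ 0 := by
  by_contra! h
  obtain ⟨c, hc⟩ := L.isOpen_compl_lattice.exists_is_const_of_deriv_eq_zero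
    L.isPreconnected_compl_lattice L.differentiableOn_weierstrassP
    (fun z hz ↦ by rw [L.deriv_weierstrassP]; exact h z hz)
  refine L.not_tendsto_nhds_weierstrassP L.lattice.zero_mem c
    (tendsto_const_nhds.congr' ?_)
  filter_upwards [L.eventually_notMem_lattice 0] with z hz using (hc z hz).symm

lemma deriv_derivWeierstrassP {z : ℂ} (hz : z ∉ L.lattice) :
    deriv ℘'[L] z = 6 * ℘[L] z ^ 2 - L.g₂ / 2 := by
  -- Differentiating (℘')² = 4℘³ - g₂℘ - g₃ leaves a factor ℘', which the identity theorem cancels,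
  -- zeros included.
  have key : ∀ z ∈ (L.lattice : Set ℂ)ᶜ,
      ℘'[L] z * (deriv ℘'[L] z - (6 * ℘[L] z ^ 2 - L.g₂ / 2)) = 0 := by
    intro z hz
    have h₁ := L.hasDerivAt_weierstrassP hz
    have h₂ := (L.analyticOnNhd_derivWeierstrassP z hz).differentiableAt.hasDerivAt
    have h₃ := (((h₁.pow 3).const_mul 4).sub (h₁.const_mul L.g₂)).sub_const L.g₃
    have h₄ := h₃.congr_of_eventuallyEq (f₁ := ℘'[L] ^ 2) (by
      filter_upwards [L.isOpen_compl_lattice.mem_nhds hz] with y hy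
      exact L.derivWeierstrassP_sq y hy)
    have := (h₂.pow 2).unique h₄
    push_cast at this
    linear_combination this / 2
  have hP := L.analyticOnNhd_weierstrassP
  rcases AnalyticOnNhd.eq_zero_or_eq_zero_of_mul_eq_zero L.analyticOnNhd_derivWeierstrassP
    (g := fun z ↦ deriv ℘'[L] z - (6 * ℘[L] z ^ 2 - L.g₂ / 2))
    (L.analyticOnNhd_derivWeierstrassP.deriv.sub
      ((analyticOnNhd_const.mul (hP.pow 2)).sub analyticOnNhd_const))
    key L.isPreconnected_compl_lattice with h | h
  · obtain ⟨y, hy, hy'⟩ := L.exists_derivWeierstrassP_ne_zero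
    exact absurd (h y hy) hy'
  · exact sub_eq_zero.mp (h z hz)

lemma hasDerivAt_derivWeierstrassP {z : ℂ} (hz : z ∉ L.lattice) :
    HasDerivAt ℘'[L] (6 * ℘[L] z ^ 2 - L.g₂ / 2) z := by
  rw [← L.deriv_derivWeierstrassP hz]
  exact (L.analyticOnNhd_derivWeierstrassP z hz).differentiableAt.hasDerivAt

lemma sumInvPow_four {w : ℂ} (hw : w ∉ L.lattice) :
    L.sumInvPow w 4 = ℘[L] w ^ 2 - L.g₂ / 12 := by
  have h := L.deriv_derivWeierstrassPExcept_self w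
  rw [L.derivWeierstrassPExcept_of_notMem w hw, L.deriv_derivWeierstrassP hw] at h
  linear_combination -h / 6

/-- Termwise, ℘'''' = 120 ∑ (z - l)⁻⁶, while ℘'' = 6℘² - g₂/2 gives ℘'''' = 12(℘℘')', which is
12℘℘'' where ℘' vanishes. -/
lemma sumInvPow_six {w : ℂ} (hw : w ∉ L.lattice) (hw' : ℘'[L] w = 0) :
    L.sumInvPow w 6 = ℘[L] w * (6 * ℘[L] w ^ 2 - L.g₂ / 2) / 10 := by
  have h := L.iteratedDeriv_derivWeierstrassPExcept_self w (n := 3)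
  have e₁ : deriv ℘'[L] =ᶠ[𝓝 w] fun z ↦ 6 * ℘[L] z ^ 2 - L.g₂ / 2 := by
    filter_upwards [L.isOpen_compl_lattice.mem_nhds hw] with z hz using L.deriv_derivWeierstrassP hz
  have e₂ : deriv (deriv ℘'[L]) =ᶠ[𝓝 w] fun z ↦ 12 * (℘[L] z * ℘'[L] z) := by
    filter_upwards [e₁.eventuallyEq_nhds, L.isOpen_compl_lattice.mem_nhds hw] with z hz hz'
    rw [hz.deriv_eq]
    convert! ((((L.hasDerivAt_weierstrassP hz').pow 2).const_mul 6).sub_const (L.g₂ / 2)).deriv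
      using 1
    push_cast
    ring
  have e₃ : deriv (deriv (deriv ℘'[L])) w = 12 * (℘[L] w * (6 * ℘[L] w ^ 2 - L.g₂ / 2)) := by
    rw [e₂.deriv_eq]
    convert! (((L.hasDerivAt_weierstrassP hw).mul
      (L.hasDerivAt_derivWeierstrassP hw)).const_mul 12).deriv using 1
    rw [hw']
    ring
  rw [L.derivWeierstrassPExcept_of_notMem w hw, iteratedDeriv_succ, iteratedDeriv_succ,
    iteratedDeriv_one, e₃] at h
  norm_num [Nat.factorial] at h
  linear_combination -h / 120

/-- Uniqueness for the second order equation ℘'' = 6℘² - g₂/2: the difference D of the translates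
satisfies D'' = 6D(℘₁ + ℘₂) with D(0) = D'(0) = 0. -/
lemma eventuallyEq_of_weierstrassP_eq {w₁ w₂ : ℂ} (h₁ : w₁ ∉ L.lattice) (h₂ : w₂ ∉ L.lattice)
    (h : ℘[L] w₁ = ℘[L] w₂) (h' : ℘'[L] w₁ = ℘'[L] w₂) :
    (fun z ↦ ℘[L] (z + w₁)) =ᶠ[𝓝 0] fun z ↦ ℘[L] (z + w₂) := by
  have mem : ∀ w ∉ L.lattice, ∀ᶠ z in 𝓝 (0 : ℂ), z + w ∉ L.lattice := fun w hw ↦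
    (by fun_prop : Continuous fun z : ℂ ↦ z + w).continuousAt.eventually_mem
      (L.isOpen_compl_lattice.mem_nhds (by simpa using hw))
  have an : ∀ w ∉ L.lattice, AnalyticAt ℂ (fun z ↦ ℘[L] (z + w)) 0 := fun w hw ↦
    AnalyticAt.fun_comp (g := ℘[L]) (f := fun z ↦ z + w)
      (L.analyticOnNhd_weierstrassP _ (by simpa using hw)) (by fun_prop)
  set D : ℂ → ℂ := fun z ↦ ℘[L] (z + w₁) - ℘[L] (z + w₂) with hD
  have hDa : AnalyticAt ℂ D 0 := (an _ h₁).sub (an _ h₂)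
  have d₁ : deriv D =ᶠ[𝓝 0] fun z ↦ ℘'[L] (z + w₁) - ℘'[L] (z + w₂) := by
    filter_upwards [mem _ h₁, mem _ h₂] with z hz₁ hz₂
    exact (((L.hasDerivAt_weierstrassP hz₁).comp_add_const z w₁).sub
      ((L.hasDerivAt_weierstrassP hz₂).comp_add_const z w₂)).deriv
  have d₂ : deriv (deriv D) =ᶠ[𝓝 0] D * fun z ↦ 6 * (℘[L] (z + w₁) + ℘[L] (z + w₂)) := by
    filter_upwards [mem _ h₁, mem _ h₂, d₁.eventuallyEq_nhds] with z hz₁ hz₂ hz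
    rw [hz.deriv_eq]
    refine (((L.hasDerivAt_derivWeierstrassP hz₁).comp_add_const z w₁).sub
      ((L.hasDerivAt_derivWeierstrassP hz₂).comp_add_const z w₂)).deriv.trans ?_
    simp only [hD, Pi.mul_apply]
    ring
  have hord : analyticOrderAt D 0 = ⊤ := by
    have o₁ := hDa.deriv.analyticOrderAt_deriv_add_one
    have o₀ := hDa.analyticOrderAt_deriv_add_one
    have hD0 : D 0 = 0 := by simp [hD, h]
    have hD1 : deriv D 0 = 0 := by rw [d₁.eq_of_nhds]; simp [h']
    simp only [hD0, hD1, sub_zero] at o₀ o₁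
    -- If n is the order of D and m that of its cofactor in D'', then n = n + m + 2, impossible for
    -- finite n.
    rw [analyticOrderAt_congr d₂, analyticOrderAt_mul hDa
      (by have := an _ h₁; have := an _ h₂; fun_prop)] at o₁
    rw [← o₁] at o₀
    by_contra hne
    lift analyticOrderAt D 0 to ℕ using hne with n
    generalize analyticOrderAt (fun z ↦ 6 * (℘[L] (z + w₁) + ℘[L] (z + w₂))) (0 : ℂ) = m at o₀
    induction m using ENat.recTopCoe with
    | top => simp at o₀
    | coe m => norm_cast at o₀; omega
  filter_upwards [analyticOrderAt_eq_top.mp hord] with z hz using sub_eq_zero.mp hz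

/-- The local equality of translates spreads over the connected complement of their poles. If w₁ -
w₂ were not a period, the pole at 0 would be carried to a regular point. -/
lemma sub_mem_lattice_of_weierstrassP_eq {w₁ w₂ : ℂ} (h₁ : w₁ ∉ L.lattice) (h₂ : w₂ ∉ L.lattice)
    (h : ℘[L] w₁ = ℘[L] w₂) (h' : ℘'[L] w₁ = ℘'[L] w₂) : w₁ - w₂ ∈ L.lattice := by
  by_contra hmem
  have hev := L.eventuallyEq_of_weierstrassP_eq h₁ h₂ h h'
  have hcount : ((fun z ↦ z + w₁) ⁻¹' (L.lattice : Set ℂ) ∪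
      (fun z ↦ z + w₂) ⁻¹' (L.lattice : Set ℂ)).Countable := by
    have hc : (L.lattice : Set ℂ).Countable :=
      Set.countable_coe_iff.mp (inferInstanceAs (Countable L.lattice))
    exact (hc.preimage (add_left_injective w₁)).union (hc.preimage (add_left_injective w₂))
  have hconn := (hcount.isConnected_compl_of_one_lt_rank (by simp)).2
  have an : ∀ w z, z + w ∉ L.lattice → AnalyticAt ℂ (fun z ↦ ℘[L] (z + w)) z := fun w z hw ↦
    AnalyticAt.fun_comp (g := ℘[L]) (f := fun z ↦ z + w)
      (L.analyticOnNhd_weierstrassP _ hw) (by fun_prop)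
  have heq := AnalyticOnNhd.eqOn_of_preconnected_of_eventuallyEq (𝕜 := ℂ)
    (U := ((fun z ↦ z + w₁) ⁻¹' (L.lattice : Set ℂ) ∪ (fun z ↦ z + w₂) ⁻¹' (L.lattice : Set ℂ))ᶜ)
    (fun z hz ↦ an w₁ z fun hz' ↦ hz (.inl hz')) (fun z hz ↦ an w₂ z fun hz' ↦ hz (.inr hz'))
    hconn (z₀ := 0) (by simp [h₁, h₂]) hev
  have hc : ContinuousAt (fun u ↦ ℘[L] (u + (w₁ - w₂))) 0 :=
    (AnalyticAt.fun_comp (g := ℘[L]) (f := fun z ↦ z + (w₁ - w₂))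
      (L.analyticOnNhd_weierstrassP _ (by simpa using hmem)) (by fun_prop)).continuousAt
  refine L.not_tendsto_nhds_weierstrassP L.lattice.zero_mem _
    ((hc.tendsto.mono_left nhdsWithin_le_nhds).congr' ?_)
  filter_upwards [L.eventually_notMem_lattice 0, nhdsWithin_le_nhds
    ((by fun_prop : Continuous fun z : ℂ ↦ z + (w₁ - w₂)).continuousAt.eventually_mem
      (L.isOpen_compl_lattice.mem_nhds (x := 0 + (w₁ - w₂)) (by simpa using hmem)))] with u hu hu'
  have := heq (x := u - w₂) (by
    rintro (h | h)
    · exact hu' (by rwa [Set.mem_preimage, show u - w₂ + w₁ = u + (w₁ - w₂) by ring] at h)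
    · exact hu (by simpa using h))
  simp only [sub_add_cancel] at this
  rw [← this]
  congr 1
  ring

lemma derivWeierstrassP_eq_zero_of_two_mul_mem {w : ℂ} (h2 : 2 * w ∈ L.lattice) :
    ℘'[L] w = 0 := by
  have h := L.derivWeierstrassP_sub_coe w ⟨_, h2⟩
  rw [show w - 2 * w = -w by ring, L.derivWeierstrassP_neg] at h
  linear_combination -h / 2

end PeriodPair

/-! ### Lattices, period pairs and subgroups of index 2. -/

theorem exists_periodPair_of_span_eq_top (Γ : AddSubgroup ℂ) (hd : DiscreteTopology Γ)
    (hs : Submodule.span ℝ (Γ : Set ℂ) = ⊤) :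
    ∃ L : PeriodPair, L.lattice.toAddSubgroup = Γ := by
  let Λ : Submodule ℤ ℂ := AddSubgroup.toIntSubmodule Γ
  have : DiscreteTopology Λ := hd
  have : IsZLattice ℝ Λ := ⟨hs⟩
  have : Module.Free ℤ Λ := ZLattice.module_free ℝ Λ
  let b := Module.finBasisOfFinrankEq ℤ Λ
    ((ZLattice.rank ℝ Λ).trans Complex.finrank_real_complex)
  have hb : Set.range (b.ofZLatticeBasis ℝ) = {(b 0 : ℂ), (b 1 : ℂ)} := by
    ext x; simp [Fin.exists_fin_two, eq_comm]
  refine ⟨⟨b 0, b 1, ?_⟩, ?_⟩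
  · convert! (b.ofZLatticeBasis ℝ).linearIndependent using 1
    ext i; fin_cases i <;> simp
  · rw [PeriodPair.lattice, ← hb, b.ofZLatticeBasis_span ℝ]
    rfl

theorem IsComplexLattice.exists_periodPair {Γ : AddSubgroup ℂ} (h : IsComplexLattice Γ) :
    ∃ L : PeriodPair, L.lattice.toAddSubgroup = Γ := by
  refine exists_periodPair_of_span_eq_top Γ h.1 (Submodule.eq_top_of_finrank_eq ?_)
  have e : Submodule.span ℤ (Γ : Set ℂ) = AddSubgroup.toIntSubmodule Γ :=
    Submodule.span_eq (AddSubgroup.toIntSubmodule Γ)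
  have hd : DiscreteTopology (Submodule.span ℤ (Γ : Set ℂ)) := by rw [e]; exact h.1
  have := Real.finrank_eq_int_finrank_of_discrete hd
  rw [Set.finrank, Set.finrank, e] at this
  rw [this, Complex.finrank_real_complex]
  exact h.2

theorem PeriodPair.isComplexLattice (L : PeriodPair) :
    IsComplexLattice L.lattice.toAddSubgroup :=
  ⟨inferInstanceAs (DiscreteTopology L.lattice), L.finrank_lattice⟩

theorem IsIndexTwoSubgroup.two_mul_mem {Γ G : AddSubgroup ℂ} (h : IsIndexTwoSubgroup Γ G)
    {x : ℂ} (hx : x ∈ Γ) : 2 * x ∈ G := by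
  have := AddSubgroup.two_smul_mem_of_index_two h.2 ⟨x, hx⟩
  simpa [AddSubgroup.mem_addSubgroupOf] using this

theorem IsIndexTwoSubgroup.add_mem_iff {Γ G : AddSubgroup ℂ} (h : IsIndexTwoSubgroup Γ G)
    {x y : ℂ} (hx : x ∈ Γ) (hy : y ∈ Γ) : x + y ∈ G ↔ (x ∈ G ↔ y ∈ G) := by
  have := AddSubgroup.add_mem_iff_of_index_two h.2 (a := ⟨x, hx⟩) (b := ⟨y, hy⟩)
  simpa [AddSubgroup.mem_addSubgroupOf] using this

theorem IsIndexTwoSubgroup.intCast_mul_mem_iff {Γ G : AddSubgroup ℂ}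
    (h : IsIndexTwoSubgroup Γ G) {x : ℂ} (hx : x ∈ Γ) (m : ℤ) :
    m * x ∈ G ↔ (x ∈ G ∨ Even m) := by
  have hmem (k : ℤ) : k * x ∈ Γ := by simpa using Γ.zsmul_mem hx k
  obtain ⟨k, rfl | rfl⟩ := m.even_or_odd'
  · have := h.two_mul_mem (hmem k)
    simp [mul_assoc, this]
  · have h2 := h.two_mul_mem (hmem k)
    have : ((2 * k + 1 : ℤ) : ℂ) * x = 2 * (k * x) + x := by push_cast; ring
    rw [this, G.add_mem_cancel_left h2]
    simp

theorem IsIndexTwoSubgroup.isComplexLattice {Γ G : AddSubgroup ℂ} (h : IsIndexTwoSubgroup Γ G)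
    (hΓ : IsComplexLattice Γ) : IsComplexLattice G := by
  obtain ⟨L, rfl⟩ := hΓ.exists_periodPair
  have hd : DiscreteTopology G :=
    DiscreteTopology.of_subset (s := (L.lattice : Set ℂ))
      (inferInstanceAs (DiscreteTopology L.lattice)) h.1
  -- G contains 2Λ, so it has the same real span as Λ.
  obtain ⟨L', rfl⟩ := exists_periodPair_of_span_eq_top G hd (by
    rw [eq_top_iff, ← IsZLattice.span_top (K := ℝ) (L := L.lattice), Submodule.span_le]
    intro x hx
    have := Submodule.smul_mem _ (2⁻¹ : ℝ) (Submodule.subset_span (R := ℝ) (h.two_mul_mem hx))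
    simpa using this)
  exact L'.isComplexLattice

/-! ### Index 2 subgroups and half periods. -/

namespace PeriodPair
variable (L : PeriodPair)

lemma half_mem_lattice_iff (m n : ℤ) :
    (m * L.ω₁ + n * L.ω₂) / 2 ∈ L.lattice ↔ Even m ∧ Even n := by
  rw [mem_lattice]
  constructor
  · rintro ⟨a, b, e⟩
    have := LinearIndependent.pair_iff.mp L.indep (2 * a - m) (2 * b - n) (by
      simp only [Complex.real_smul]; push_cast; linear_combination 2 * e)
    obtain ⟨h₁, h₂⟩ := this
    have h₁ : m = 2 * a := by exact_mod_cast (sub_eq_zero.mp h₁).symm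
    have h₂ : n = 2 * b := by exact_mod_cast (sub_eq_zero.mp h₂).symm
    exact ⟨h₁ ▸ even_two_mul a, h₂ ▸ even_two_mul b⟩
  · rintro ⟨⟨a, rfl⟩, ⟨b, rfl⟩⟩
    exact ⟨a, b, by push_cast; ring⟩

lemma half_sub_half_mem_lattice_iff (m n a b : ℤ) :
    (m * L.ω₁ + n * L.ω₂) / 2 - (a * L.ω₁ + b * L.ω₂) / 2 ∈ L.lattice ↔
      Even (m - a) ∧ Even (n - b) := by
  rw [← half_mem_lattice_iff]
  push_cast
  ring_nf

/-- The subgroup `2 Λ ∪ (2 w + 2 Λ)` attached to a half period `w` of `Λ`. -/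
def indexTwoSubgroup (w : ℂ) (h : 2 * w ∈ L.lattice) : AddSubgroup ℂ where
  carrier := {x | x / 2 ∈ L.lattice ∨ x / 2 - w ∈ L.lattice}
  zero_mem' := .inl (by simp)
  add_mem' := by
    rintro x y (hx | hx) (hy | hy)
    · left; simpa [add_div] using add_mem hx hy
    · right; convert! add_mem hx hy using 1; ring
    · right; convert! add_mem hx hy using 1; ring
    · left; convert! add_mem (add_mem hx hy) h using 1; ring
  neg_mem' := by
    rintro x (hx | hx)
    · left; simpa [neg_div] using neg_mem hx
    · right; convert! sub_mem (neg_mem hx) h using 1; ring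

lemma mem_indexTwoSubgroup {w : ℂ} {h : 2 * w ∈ L.lattice} {x : ℂ} :
    x ∈ L.indexTwoSubgroup w h ↔ x / 2 ∈ L.lattice ∨ x / 2 - w ∈ L.lattice := Iff.rfl

lemma indexTwoSubgroup_congr {w w' : ℂ} {h : 2 * w ∈ L.lattice} {h' : 2 * w' ∈ L.lattice}
    (hw : w - w' ∈ L.lattice) : L.indexTwoSubgroup w h = L.indexTwoSubgroup w' h' := by
  ext x
  have : x / 2 - w' = (x / 2 - w) + (w - w') := by ring
  rw [mem_indexTwoSubgroup, mem_indexTwoSubgroup, this, L.lattice.add_mem_iff_left hw]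

lemma isIndexTwoSubgroup_indexTwoSubgroup {w : ℂ} (h : 2 * w ∈ L.lattice)
    (hw : w ∉ L.lattice) :
    IsIndexTwoSubgroup L.lattice.toAddSubgroup (L.indexTwoSubgroup w h) := by
  obtain ⟨a, b, hab⟩ := mem_lattice.mp h
  obtain rfl : w = (a * L.ω₁ + b * L.ω₂) / 2 := by rw [hab]; ring
  rw [half_mem_lattice_iff] at hw
  have key (m n : ℤ) : m * L.ω₁ + n * L.ω₂ ∈ L.indexTwoSubgroup _ h ↔
      (Even m ∧ Even n) ∨ (Even (m - a) ∧ Even (n - b)) := by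
    rw [mem_indexTwoSubgroup, half_mem_lattice_iff, half_sub_half_mem_lattice_iff]
  refine ⟨?_, AddSubgroup.relIndex_eq_two_iff_exists_notMem_and.mpr ?_⟩
  · rintro x (hx | hx)
    · have := add_mem hx hx
      rwa [add_halves] at this
    · have := add_mem (add_mem hx hx) h
      convert! this using 1
      ring
  · have hadd (m n s t : ℤ) : (m * L.ω₁ + n * L.ω₂) + (s * L.ω₁ + t * L.ω₂) =
      (m + s : ℤ) * L.ω₁ + (n + t : ℤ) * L.ω₂ := by push_cast; ring
    -- An odd determinant puts (s, t) off the line spanned by (a, b) in Λ/2Λ ≅ 𝔽₂².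
    obtain ⟨s, t, hst⟩ : ∃ s t : ℤ, ¬ Even (a * t - b * s) := by
      rw [not_and_or] at hw
      rcases hw with hw | hw
      · exact ⟨0, 1, by simpa using hw⟩
      · exact ⟨1, 0, by simpa using hw⟩
    refine ⟨s * L.ω₁ + t * L.ω₂, mem_lattice.mpr ⟨s, t, rfl⟩, ?_, ?_⟩
    · rw [key]
      simp only [Int.even_sub, Int.even_mul] at *
      tauto
    · intro x hx
      obtain ⟨m, n, rfl⟩ := mem_lattice.mp hx
      rw [hadd, key, key]
      simp only [Int.even_sub, Int.even_mul, Int.even_add] at *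
      tauto

lemma _root_.IsIndexTwoSubgroup.exists_eq_indexTwoSubgroup {G : AddSubgroup ℂ}
    (hG : IsIndexTwoSubgroup L.lattice.toAddSubgroup G) :
    ∃ (w : ℂ) (h : 2 * w ∈ L.lattice), w ∉ L.lattice ∧ G = L.indexTwoSubgroup w h := by
  have h₁ : L.ω₁ ∈ L.lattice.toAddSubgroup := L.ω₁_mem_lattice
  have h₂ : L.ω₂ ∈ L.lattice.toAddSubgroup := L.ω₂_mem_lattice
  have hz {x : ℂ} (hx : x ∈ L.lattice.toAddSubgroup) (k : ℤ) :
    k * x ∈ L.lattice.toAddSubgroup := by simpa using L.lattice.toAddSubgroup.zsmul_mem hx k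
  have key (m n : ℤ) : m * L.ω₁ + n * L.ω₂ ∈ G ↔
      ((L.ω₁ ∈ G ∨ Even m) ↔ (L.ω₂ ∈ G ∨ Even n)) := by
    rw [hG.add_mem_iff (hz h₁ m) (hz h₂ n), hG.intCast_mul_mem_iff h₁, hG.intCast_mul_mem_iff h₂]
  have hnot : ¬ (L.ω₁ ∈ G ∧ L.ω₂ ∈ G) := by
    rintro ⟨h₁, h₂⟩
    obtain ⟨x, hx, hx', -⟩ := AddSubgroup.relIndex_eq_two_iff_exists_notMem_and.mp hG.2
    obtain ⟨m, n, rfl⟩ := mem_lattice.mp hx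
    exact hx' ((key m n).mpr (by simp [h₁, h₂]))
  have hab : ∃ a b : ℤ, ¬ (Even a ∧ Even b) ∧ ∀ m n : ℤ,
      ((L.ω₁ ∈ G ∨ Even m) ↔ (L.ω₂ ∈ G ∨ Even n)) ↔
        (Even m ∧ Even n) ∨ (Even (m - a) ∧ Even (n - b)) := by
    -- G/2Λ is a line in 𝔽₂², and (a, b) is its nonzero vector.
    by_cases p : L.ω₁ ∈ G <;> by_cases q : L.ω₂ ∈ G
    · exact absurd ⟨p, q⟩ hnot
    · refine ⟨1, 0, by simp, fun m n ↦ ?_⟩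
      simp only [p, q, Int.even_sub, Int.not_even_one, Even.zero]; tauto
    · refine ⟨0, 1, by simp, fun m n ↦ ?_⟩
      simp only [p, q, Int.even_sub, Int.not_even_one, Even.zero]; tauto
    · refine ⟨1, 1, by simp, fun m n ↦ ?_⟩
      simp only [p, q, Int.even_sub, Int.not_even_one]; tauto
  obtain ⟨a, b, hne, hab⟩ := hab
  have h2 : 2 * ((a * L.ω₁ + b * L.ω₂) / 2) ∈ L.lattice :=
    mem_lattice.mpr ⟨a, b, by ring⟩
  have hw : (a * L.ω₁ + b * L.ω₂) / 2 ∉ L.lattice := by rwa [half_mem_lattice_iff]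
  refine ⟨_, h2, hw, ?_⟩
  have mem (m n : ℤ) : m * L.ω₁ + n * L.ω₂ ∈ G ↔
      m * L.ω₁ + n * L.ω₂ ∈ L.indexTwoSubgroup _ h2 := by
    rw [key, hab, mem_indexTwoSubgroup, half_mem_lattice_iff, half_sub_half_mem_lattice_iff]
  ext x
  constructor <;> intro hx
  · obtain ⟨m, n, rfl⟩ := mem_lattice.mp (hG.1 hx)
    exact (mem m n).mp hx
  · obtain ⟨m, n, rfl⟩ := mem_lattice.mp ((L.isIndexTwoSubgroup_indexTwoSubgroup h2 hw).1 hx)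
    exact (mem m n).mpr hx

/-! ### Eisenstein sums of index 2 subgroups. -/

lemma hasSum_subtype_ne_zero_iff {G : AddSubgroup ℂ} {f : ℂ → ℂ} (hf : f 0 = 0) {a : ℂ} :
    HasSum (fun u : {u : ℂ // u ∈ G ∧ u ≠ 0} ↦ f u) a ↔ HasSum (fun u : G ↦ f u) a := by
  have h₁ := hasSum_subtype_iff_indicator (f := f) (a := a) (s := {u : ℂ | u ∈ G ∧ u ≠ 0})
  have h₂ := hasSum_subtype_iff_indicator (f := f) (a := a) (s := (G : Set ℂ))
  have e : Set.indicator {u : ℂ | u ∈ G ∧ u ≠ 0} f = Set.indicator (G : Set ℂ) f := by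
    ext u
    by_cases hu : u = 0 <;> by_cases hG : u ∈ G <;> simp [hu, hG, hf]
  rw [e, ← h₂] at h₁
  exact h₁

lemma hasSum_inv_pow_lattice {r : ℕ} (hr : 2 < r) :
    HasSum (fun u : {u : ℂ // u ∈ L.lattice.toAddSubgroup ∧ u ≠ 0} ↦ ((u : ℂ) ^ r)⁻¹)
      (L.G r) := by
  -- Since `0⁻¹ = 0`, the origin may be included in the sum.
  rw [hasSum_subtype_ne_zero_iff (f := fun u ↦ (u ^ r)⁻¹) (by simp; omega), ← L.sumInvPow_zero]
  have := L.hasSum_sumInvPow 0 hr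
  simp only [sub_zero] at this
  exact this

lemma hasSum_inv_pow_indexTwoSubgroup {w : ℂ} (h : 2 * w ∈ L.lattice) (hw : w ∉ L.lattice)
    {r : ℕ} (hr : 2 < r) :
    HasSum (fun u : {u : ℂ // u ∈ L.indexTwoSubgroup w h ∧ u ≠ 0} ↦ ((u : ℂ) ^ r)⁻¹)
      ((2 ^ r)⁻¹ * (L.G r + L.sumInvPow w r)) := by
  rw [hasSum_subtype_ne_zero_iff (f := fun u ↦ (u ^ r)⁻¹) (by simp; omega)]
  have hsum (x : ℂ) : HasSum ((fun u : ℂ ↦ (u ^ r)⁻¹) ∘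
      ((↑) : Set.range (fun l : L.lattice ↦ 2 * (l - x)) → ℂ)) ((2 ^ r)⁻¹ * L.sumInvPow x r) := by
    have hinj : Function.Injective (fun l : L.lattice ↦ 2 * ((l : ℂ) - x)) := by
      intro a b hab
      simpa using hab
    refine (hinj.hasSum_range_iff (f := fun u : ℂ ↦ (u ^ r)⁻¹)).mpr ?_
    simpa [Function.comp_def, mul_pow, mul_comm] using (L.hasSum_sumInvPow x hr).mul_left (2 ^ r)⁻¹
  -- The two cosets 2Λ and 2w + 2Λ; the latter is also 2Λ - 2w because 2w ∈ Λ.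
  have hset : (L.indexTwoSubgroup w h : Set ℂ) =
      Set.range (fun l : L.lattice ↦ 2 * ((l : ℂ) - 0)) ∪
        Set.range (fun l : L.lattice ↦ 2 * ((l : ℂ) - w)) := by
    ext x
    simp only [SetLike.mem_coe, mem_indexTwoSubgroup, Set.mem_union, Set.mem_range]
    refine or_congr ⟨fun hx ↦ ⟨⟨_, hx⟩, by ring⟩, ?_⟩ ⟨fun hx ↦ ⟨⟨_, add_mem hx h⟩, by ring⟩, ?_⟩
    · rintro ⟨l, rfl⟩
      simp
    · rintro ⟨l, rfl⟩
      convert! sub_mem l.2 h using 1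
      ring
  have hdisj : Disjoint (Set.range (fun l : L.lattice ↦ 2 * ((l : ℂ) - 0)))
      (Set.range (fun l : L.lattice ↦ 2 * ((l : ℂ) - w))) := by
    rw [Set.disjoint_left]
    rintro _ ⟨l, rfl⟩ ⟨l', hl'⟩
    refine hw ?_
    convert! sub_mem l'.2 l.2 using 1
    linear_combination -hl' / 2
  have := HasSum.add_disjoint hdisj (hsum 0) (hsum w)
  rw [← hset, L.sumInvPow_zero, ← mul_add] at this
  exact this

lemma weierstrassG2_lattice : weierstrassG2 L.lattice.toAddSubgroup = L.g₂ :=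
  ((L.hasSum_inv_pow_lattice (r := 4) (by norm_num)).mul_left 60).tsum_eq

lemma weierstrassG3_lattice : weierstrassG3 L.lattice.toAddSubgroup = L.g₃ :=
  ((L.hasSum_inv_pow_lattice (r := 6) (by norm_num)).mul_left 140).tsum_eq

lemma cubic_weierstrassP_eq_zero {w : ℂ} (h : 2 * w ∈ L.lattice) (hw : w ∉ L.lattice) :
    4 * ℘[L] w ^ 3 - L.g₂ * ℘[L] w - L.g₃ = 0 := by
  rw [← L.derivWeierstrassP_sq w hw, L.derivWeierstrassP_eq_zero_of_two_mul_mem h]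
  norm_num

lemma weierstrassG2_indexTwoSubgroup {w : ℂ} (h : 2 * w ∈ L.lattice) (hw : w ∉ L.lattice) :
    16 * weierstrassG2 (L.indexTwoSubgroup w h) = 60 * ℘[L] w ^ 2 - 4 * L.g₂ := by
  have e : weierstrassG2 (L.indexTwoSubgroup w h) = _ :=
    ((L.hasSum_inv_pow_indexTwoSubgroup h hw (r := 4) (by norm_num)).mul_left 60).tsum_eq
  rw [e, L.sumInvPow_four hw, PeriodPair.g₂]
  ring

lemma weierstrassG3_indexTwoSubgroup {w : ℂ} (h : 2 * w ∈ L.lattice) (hw : w ∉ L.lattice) :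
    64 * weierstrassG3 (L.indexTwoSubgroup w h) = 22 * L.g₃ + 14 * L.g₂ * ℘[L] w := by
  have e : weierstrassG3 (L.indexTwoSubgroup w h) = _ :=
    ((L.hasSum_inv_pow_indexTwoSubgroup h hw (r := 6) (by norm_num)).mul_left 140).tsum_eq
  have h₁ := L.cubic_weierstrassP_eq_zero h hw
  rw [e, L.sumInvPow_six hw (L.derivWeierstrassP_eq_zero_of_two_mul_mem h)]
  have h₂ : 140 * L.G 6 = L.g₃ := rfl
  linear_combination h₂ + 21 * h₁

end PeriodPair

/-! ### Roots of the cubic and the size of the discriminant. -/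

theorem cubic_coeffs_of_roots {a b e₁ e₂ e₃ : ℂ} (h₁ : 4 * e₁ ^ 3 - a * e₁ - b = 0)
    (h₂ : 4 * e₂ ^ 3 - a * e₂ - b = 0) (h₃ : 4 * e₃ ^ 3 - a * e₃ - b = 0)
    (h₁₂ : e₁ ≠ e₂) (h₁₃ : e₁ ≠ e₃) (h₂₃ : e₂ ≠ e₃) :
    e₁ + e₂ + e₃ = 0 ∧ a = -4 * (e₁ * e₂ + e₁ * e₃ + e₂ * e₃) ∧ b = 4 * (e₁ * e₂ * e₃) := by
  have h12 : 4 * (e₁ ^ 2 + e₁ * e₂ + e₂ ^ 2) - a = 0 := by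
    apply mul_left_cancel₀ (sub_ne_zero.mpr h₁₂); linear_combination h₁ - h₂
  have h13 : 4 * (e₁ ^ 2 + e₁ * e₃ + e₃ ^ 2) - a = 0 := by
    apply mul_left_cancel₀ (sub_ne_zero.mpr h₁₃); linear_combination h₁ - h₃
  have hs : e₁ + e₂ + e₃ = 0 := by
    apply mul_left_cancel₀ (sub_ne_zero.mpr h₂₃); linear_combination (h12 - h13) / 4
  obtain rfl : e₃ = -e₁ - e₂ := by linear_combination hs
  obtain rfl : a = 4 * (e₁ ^ 2 + e₁ * e₂ + e₂ ^ 2) := by linear_combination -h12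
  refine ⟨hs, by ring, by linear_combination -h₁⟩

theorem eq_or_eq_or_eq_of_cubic {a b e₁ e₂ e₃ x : ℂ} (h₁ : 4 * e₁ ^ 3 - a * e₁ - b = 0)
    (h₂ : 4 * e₂ ^ 3 - a * e₂ - b = 0) (h₃ : 4 * e₃ ^ 3 - a * e₃ - b = 0)
    (h₁₂ : e₁ ≠ e₂) (h₁₃ : e₁ ≠ e₃) (h₂₃ : e₂ ≠ e₃) (hx : 4 * x ^ 3 - a * x - b = 0) :
    x = e₁ ∨ x = e₂ ∨ x = e₃ := by
  obtain ⟨hs, ha, hb⟩ := cubic_coeffs_of_roots h₁ h₂ h₃ h₁₂ h₁₃ h₂₃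
  have : (x - e₁) * ((x - e₂) * (x - e₃)) = 0 := by
    linear_combination hx / 4 + x / 4 * ha + hb / 4 - x ^ 2 * hs
  simpa [sub_eq_zero] using this

/-- The subgroups of index `2` of a lattice correspond to the roots of `4 x³ - g₂ x - g₃`, which
are distinct, and the invariants of such a subgroup are polynomials in the corresponding root. -/
theorem IsComplexLattice.exists_bijOn_roots {Γ : AddSubgroup ℂ} (hΓ : IsComplexLattice Γ) :
    ∃ e : AddSubgroup ℂ → ℂ,
      Set.BijOn e {G | IsIndexTwoSubgroup Γ G}
        {x | 4 * x ^ 3 - weierstrassG2 Γ * x - weierstrassG3 Γ = 0} ∧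
      (∀ G, IsIndexTwoSubgroup Γ G →
        16 * weierstrassG2 G = 60 * e G ^ 2 - 4 * weierstrassG2 Γ ∧
        64 * weierstrassG3 G = 22 * weierstrassG3 Γ + 14 * weierstrassG2 Γ * e G) ∧
      ∃ e₁ e₂ e₃ : ℂ, e₁ ≠ e₂ ∧ e₁ ≠ e₃ ∧ e₂ ≠ e₃ ∧
        4 * e₁ ^ 3 - weierstrassG2 Γ * e₁ - weierstrassG3 Γ = 0 ∧
        4 * e₂ ^ 3 - weierstrassG2 Γ * e₂ - weierstrassG3 Γ = 0 ∧
        4 * e₃ ^ 3 - weierstrassG2 Γ * e₃ - weierstrassG3 Γ = 0 := by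
  obtain ⟨L, rfl⟩ := hΓ.exists_periodPair
  rw [L.weierstrassG2_lattice, L.weierstrassG3_lattice]
  choose! w h hw hG using fun G (hG : IsIndexTwoSubgroup L.lattice.toAddSubgroup G) ↦
    hG.exists_eq_indexTwoSubgroup L
  have inj {v v' : ℂ} (h : 2 * v ∈ L.lattice) (hv : v ∉ L.lattice) (h' : 2 * v' ∈ L.lattice)
      (hv' : v' ∉ L.lattice) (heq : ℘[L] v = ℘[L] v') : v - v' ∈ L.lattice :=
    L.sub_mem_lattice_of_weierstrassP_eq hv hv' heq (by
      rw [L.derivWeierstrassP_eq_zero_of_two_mul_mem h,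
        L.derivWeierstrassP_eq_zero_of_two_mul_mem h'])
  have hp (a b : ℤ) : 2 * ((a * L.ω₁ + b * L.ω₂) / 2) ∈ L.lattice :=
    mem_lattice.mpr ⟨a, b, by ring⟩
  have hn (a b : ℤ) (hab : ¬ (Even a ∧ Even b)) : (a * L.ω₁ + b * L.ω₂) / 2 ∉ L.lattice := by
    rwa [half_mem_lattice_iff]
  let E : ℤ → ℤ → ℂ := fun a b ↦ ℘[L] ((a * L.ω₁ + b * L.ω₂) / 2)
  have hE (a b : ℤ) (hab : ¬ (Even a ∧ Even b)) : 4 * E a b ^ 3 - L.g₂ * E a b - L.g₃ = 0 :=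
    L.cubic_weierstrassP_eq_zero (hp a b) (hn a b hab)
  have hne (a b a' b' : ℤ) (hab : ¬ (Even a ∧ Even b)) (hab' : ¬ (Even a' ∧ Even b'))
      (hd : ¬ (Even (a - a') ∧ Even (b - b'))) : E a b ≠ E a' b' := fun heq ↦ by
    have := inj (hp a b) (hn a b hab) (hp a' b') (hn a' b' hab') heq
    rw [half_sub_half_mem_lattice_iff] at this
    exact hd this
  have r₁ := hE 1 0 (by simp)
  have r₂ := hE 0 1 (by simp)
  have r₃ := hE 1 1 (by simp)
  have h₁₂ := hne 1 0 0 1 (by simp) (by simp) (by simp)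
  have h₁₃ := hne 1 0 1 1 (by simp) (by simp) (by simp)
  have h₂₃ := hne 0 1 1 1 (by simp) (by simp) (by simp)
  refine ⟨fun G ↦ ℘[L] (w G), ⟨?_, ?_, ?_⟩, ?_, _, _, _, h₁₂, h₁₃, h₂₃, r₁, r₂, r₃⟩
  · intro G hG'
    exact L.cubic_weierstrassP_eq_zero (h G hG') (hw G hG')
  · intro G hG₁ G' hG₂ heq
    rw [hG G hG₁, hG G' hG₂]
    exact L.indexTwoSubgroup_congr (inj (h G hG₁) (hw G hG₁) (h G' hG₂) (hw G' hG₂) heq)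
  · have surj (a b : ℤ) (hab : ¬ (Even a ∧ Even b)) :
        E a b ∈ (fun G ↦ ℘[L] (w G)) '' {G | IsIndexTwoSubgroup L.lattice.toAddSubgroup G} := by
      have hG' := L.isIndexTwoSubgroup_indexTwoSubgroup (hp a b) (hn a b hab)
      set G := L.indexTwoSubgroup _ (hp a b) with hGdef
      refine ⟨G, hG', ?_⟩
      -- The half period chosen for G may differ from the given one, but only by a period, so ℘
      -- agrees on both.
      have hmem : 2 * w G ∈ G := by
        rw [hG G hG', mem_indexTwoSubgroup, ← hG G hG']
        right; simp
      rw [hGdef, mem_indexTwoSubgroup, ← hGdef, mul_div_cancel_left₀ _ two_ne_zero] at hmem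
      have hmem := hmem.resolve_left (hw G hG')
      have := L.weierstrassP_add_coe ((a * L.ω₁ + b * L.ω₂) / 2) ⟨_, hmem⟩
      simpa using this
    intro x hx
    rcases eq_or_eq_or_eq_of_cubic r₁ r₂ r₃ h₁₂ h₁₃ h₂₃ hx with rfl | rfl | rfl <;> exact surj _ _ (by simp)
  · intro G hG'
    have h₁ := L.weierstrassG2_indexTwoSubgroup (h G hG') (hw G hG')
    have h₂ := L.weierstrassG3_indexTwoSubgroup (h G hG') (hw G hG')
    rw [← hG G hG'] at h₁ h₂
    exact ⟨h₁, h₂⟩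

/-- The second factor is symmetric in a, b, c, so comparing subgroups amounts to comparing ‖b - c‖.
-/
theorem norm_weierstrassDelta_eq {Γ G : AddSubgroup ℂ} {a b c : ℂ}
    (ha : 4 * a ^ 3 - weierstrassG2 Γ * a - weierstrassG3 Γ = 0)
    (hb : 4 * b ^ 3 - weierstrassG2 Γ * b - weierstrassG3 Γ = 0)
    (hc : 4 * c ^ 3 - weierstrassG2 Γ * c - weierstrassG3 Γ = 0)
    (hab : a ≠ b) (hac : a ≠ c) (hbc : b ≠ c)
    (h₂ : 16 * weierstrassG2 G = 60 * a ^ 2 - 4 * weierstrassG2 Γ)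
    (h₃ : 64 * weierstrassG3 G = 22 * weierstrassG3 Γ + 14 * weierstrassG2 Γ * a) :
    ‖weierstrassDelta G‖ = ‖b - c‖ ^ 3 * (‖a - b‖ * ‖a - c‖ * ‖b - c‖ / 16) := by
  obtain ⟨hs, hg₂, hg₃⟩ := cubic_coeffs_of_roots ha hb hc hab hac hbc
  obtain rfl : a = -b - c := by linear_combination hs
  rw [hg₂] at h₂ h₃
  rw [hg₃] at h₃
  have h₂' : weierstrassG2 G = (60 * (-b - c) ^ 2 - 4 * (-4 * ((-b - c) * b + (-b - c) * c + b * c)))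
      / 16 := by rw [← h₂]; ring
  have h₃' : weierstrassG3 G = (22 * (4 * ((-b - c) * b * c)) +
      14 * (-4 * ((-b - c) * b + (-b - c) * c + b * c)) * (-b - c)) / 64 := by rw [← h₃]; ring
  have : weierstrassDelta G = (b - c) ^ 3 * ((-b - c - b) * (-b - c - c) * (b - c) / 16) := by
    rw [weierstrassDelta, h₂', h₃']
    ring
  simp [this]

theorem IsComplexLattice.existsUnique_isOptimalIndexTwo {Γ : AddSubgroup ℂ}
    (hΓ : IsComplexLattice Γ) {a b c : ℂ}
    (ha : 4 * a ^ 3 - weierstrassG2 Γ * a - weierstrassG3 Γ = 0)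
    (hb : 4 * b ^ 3 - weierstrassG2 Γ * b - weierstrassG3 Γ = 0)
    (hc : 4 * c ^ 3 - weierstrassG2 Γ * c - weierstrassG3 Γ = 0)
    (hab : a ≠ b) (hac : a ≠ c) (hbc : b ≠ c)
    (hb' : ‖b - c‖ < ‖a - b‖) (hc' : ‖b - c‖ < ‖a - c‖) :
    ∃! G : AddSubgroup ℂ, IsOptimalIndexTwo Γ G := by
  obtain ⟨e, ⟨hmaps, hinj, hsurj⟩, hinv, -⟩ := hΓ.exists_bijOn_roots
  obtain ⟨G, hG, rfl⟩ := hsurj ha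
  have nG := norm_weierstrassDelta_eq ha hb hc hab hac hbc (hinv G hG).1 (hinv G hG).2
  have h₁ : 0 < ‖e G - b‖ := norm_pos_iff.mpr (sub_ne_zero.mpr hab)
  have h₂ : 0 < ‖e G - c‖ := norm_pos_iff.mpr (sub_ne_zero.mpr hac)
  have h₃ : 0 < ‖b - c‖ := norm_pos_iff.mpr (sub_ne_zero.mpr hbc)
  have hlt : ∀ H, IsIndexTwoSubgroup Γ H → H ≠ G →
      ‖weierstrassDelta G‖ < ‖weierstrassDelta H‖ := by
    intro H hH hne
    obtain ⟨i₂, i₃⟩ := hinv H hH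
    rcases eq_or_eq_or_eq_of_cubic ha hb hc hab hac hbc (hmaps hH) with h | h | h
    · exact absurd (hinj hH hG h) hne
    · rw [h] at i₂ i₃
      rw [nG, norm_weierstrassDelta_eq hb ha hc hab.symm hbc hac i₂ i₃, norm_sub_rev b (e G),
        show ‖e G - b‖ * ‖b - c‖ * ‖e G - c‖ = ‖e G - b‖ * ‖e G - c‖ * ‖b - c‖ by ring]
      gcongr
    · rw [h] at i₂ i₃
      rw [nG, norm_weierstrassDelta_eq hc ha hb hac.symm hbc.symm hab i₂ i₃,
        norm_sub_rev c (e G), norm_sub_rev c b,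
        show ‖e G - c‖ * ‖b - c‖ * ‖e G - b‖ = ‖e G - b‖ * ‖e G - c‖ * ‖b - c‖ by ring]
      gcongr
  refine ⟨G, ⟨hG, fun H hH ↦ ?_⟩, fun H hH ↦ ?_⟩
  · by_cases hne : H = G
    · rw [hne]
    · exact (hlt H hH hne).le
  · by_contra hne
    exact (hH.2 G hG).not_gt (hlt H hH.1 hne)

/-- For an optimal subgroup, the two roots other than the corresponding one are closest. -/
theorem IsOptimalIndexTwo.exists_roots {Γ Γ' : AddSubgroup ℂ} (hΓ : IsComplexLattice Γ)
    (h : IsOptimalIndexTwo Γ Γ') :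
    ∃ x y z : ℂ, x ≠ y ∧ x ≠ z ∧ y ≠ z ∧ ‖y - z‖ ≤ ‖x - y‖ ∧ ‖y - z‖ ≤ ‖x - z‖ ∧
      x + y + z = 0 ∧
      16 * weierstrassG2 Γ' = 60 * x ^ 2 + 16 * (x * y + x * z + y * z) ∧
      64 * weierstrassG3 Γ' = 88 * (x * y * z) - 56 * (x * y + x * z + y * z) * x := by
  obtain ⟨e, ⟨hmaps, hinj, hsurj⟩, hinv, e₁, e₂, e₃, h₁₂, h₁₃, h₂₃, r₁, r₂, r₃⟩ :=
    hΓ.exists_bijOn_roots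
  obtain ⟨y, z, hxy, hxz, hyz, ry, rz⟩ : ∃ y z, e Γ' ≠ y ∧ e Γ' ≠ z ∧ y ≠ z ∧
      4 * y ^ 3 - weierstrassG2 Γ * y - weierstrassG3 Γ = 0 ∧
      4 * z ^ 3 - weierstrassG2 Γ * z - weierstrassG3 Γ = 0 := by
    rcases eq_or_eq_or_eq_of_cubic r₁ r₂ r₃ h₁₂ h₁₃ h₂₃ (hmaps h.1) with h | h | h <;> rw [h]
    · exact ⟨e₂, e₃, h₁₂, h₁₃, h₂₃, r₂, r₃⟩
    · exact ⟨e₁, e₃, h₁₂.symm, h₂₃, h₁₃, r₁, r₃⟩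
    · exact ⟨e₁, e₂, h₁₃.symm, h₂₃.symm, h₁₂, r₁, r₂⟩
  have rx := hmaps h.1
  obtain ⟨j₂, j₃⟩ := hinv Γ' h.1
  set x := e Γ'
  have n := norm_weierstrassDelta_eq rx ry rz hxy hxz hyz j₂ j₃
  have h₁ : 0 < ‖x - y‖ := norm_pos_iff.mpr (sub_ne_zero.mpr hxy)
  have h₂ : 0 < ‖x - z‖ := norm_pos_iff.mpr (sub_ne_zero.mpr hxz)
  have h₃ : 0 < ‖y - z‖ := norm_pos_iff.mpr (sub_ne_zero.mpr hyz)
  obtain ⟨hs, hg₂, hg₃⟩ := cubic_coeffs_of_roots rx ry rz hxy hxz hyz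
  refine ⟨x, y, z, hxy, hxz, hyz, ?_, ?_, hs, by rw [j₂, hg₂]; ring, by rw [j₃, hg₂, hg₃]; ring⟩
  -- Comparison with the subgroup at z, whose opposite pair is x, y.
  · obtain ⟨H, hH, hHe⟩ := hsurj rz
    obtain ⟨i₂, i₃⟩ := hinv H hH
    rw [hHe] at i₂ i₃
    have hle := h.2 H hH
    rw [n, norm_weierstrassDelta_eq rz rx ry hxz.symm hyz.symm hxy i₂ i₃, norm_sub_rev z x,
      norm_sub_rev z y,
      show ‖x - z‖ * ‖y - z‖ * ‖x - y‖ = ‖x - y‖ * ‖x - z‖ * ‖y - z‖ by ring] at hle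
    exact le_of_pow_le_pow_left₀ three_ne_zero h₁.le (le_of_mul_le_mul_right hle (by positivity))
  · obtain ⟨H, hH, hHe⟩ := hsurj ry
    obtain ⟨i₂, i₃⟩ := hinv H hH
    rw [hHe] at i₂ i₃
    have hle := h.2 H hH
    rw [n, norm_weierstrassDelta_eq ry rx rz hxy.symm hyz hxz i₂ i₃, norm_sub_rev y x,
      show ‖x - y‖ * ‖y - z‖ * ‖x - z‖ = ‖x - y‖ * ‖x - z‖ * ‖y - z‖ by ring] at hle
    exact le_of_pow_le_pow_left₀ three_ne_zero h₂.le (le_of_mul_le_mul_right hle (by positivity))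

/-! ### The optimal subgroup of an optimal subgroup. -/

theorem mainTheorem8 (Γ Γ' : AddSubgroup ℂ) (hΓ : IsComplexLattice Γ)
    (hΓ' : IsOptimalIndexTwo Γ Γ') :
    ∃! Γ'' : AddSubgroup ℂ, IsOptimalIndexTwo Γ' Γ'' := by
  obtain ⟨x, y, z, hxy, hxz, hyz, hy, hz, hs, hg₂, hg₃⟩ := hΓ'.exists_roots hΓ
  obtain ⟨P, hP⟩ := IsAlgClosed.exists_pow_nat_eq (x - y) (n := 2) (by norm_num)
  obtain ⟨Q, hQ, hPQ⟩ : ∃ Q : ℂ, Q ^ 2 = x - z ∧ ‖P - Q‖ ≤ ‖P + Q‖ := by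
    obtain ⟨Q, hQ⟩ := IsAlgClosed.exists_pow_nat_eq (x - z) (n := 2) (by norm_num)
    rcases le_total ‖P - Q‖ ‖P + Q‖ with h | h
    · exact ⟨Q, hQ, h⟩
    · exact ⟨-Q, by rw [neg_sq, hQ], by simpa [← sub_eq_add_neg] using h⟩
  have hP0 : P ≠ 0 := by rintro rfl; exact hxy (by linear_combination -hP)
  have hQ0 : Q ≠ 0 := by rintro rfl; exact hxz (by linear_combination -hQ)
  have hmul : (P - Q) * (P + Q) = -(y - z) := by linear_combination hP - hQ
  have hmul0 : (P - Q) * (P + Q) ≠ 0 := by rw [hmul]; exact neg_ne_zero.mpr (sub_ne_zero.mpr hyz)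
  have hsub0 : P - Q ≠ 0 := left_ne_zero_of_mul hmul0
  have hadd0 : P + Q ≠ 0 := right_ne_zero_of_mul hmul0
  have hnorm : ‖P - Q‖ * ‖P + Q‖ = ‖y - z‖ := by rw [← norm_mul, hmul, norm_neg]
  have hyP : ‖P - Q‖ * ‖P + Q‖ ≤ ‖P‖ ^ 2 := by rwa [hnorm, ← norm_pow, hP]
  have hzQ : ‖P - Q‖ * ‖P + Q‖ ≤ ‖Q‖ ^ 2 := by rwa [hnorm, ← norm_pow, hQ]
  have hpar := parallelogram_law_with_norm ℝ P Q
  have p0 : 0 < ‖P‖ := norm_pos_iff.mpr hP0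
  have q0 : 0 < ‖Q‖ := norm_pos_iff.mpr hQ0
  have n0 : 0 < ‖P - Q‖ := norm_pos_iff.mpr hsub0
  -- Equality would give ‖P - Q‖² = ‖P‖² + ‖Q‖² by the parallelogram law, against ‖P - Q‖² ≤ ‖P‖².
  have hlt : ‖P - Q‖ < ‖P + Q‖ := by
    refine lt_of_le_of_ne hPQ fun heq ↦ ?_
    rw [← heq] at hpar hyP
    nlinarith
  -- Here ‖P - Q‖ ≤ ‖P + Q‖ bounds ‖P - Q‖ by both ‖P‖ and ‖Q‖.
  have hlt' : ‖P - Q‖ ^ 2 < 4 * (‖P‖ * ‖Q‖) := by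
    have h₁ : ‖P - Q‖ ^ 2 ≤ ‖P - Q‖ * ‖P + Q‖ := by nlinarith
    have hp : ‖P - Q‖ ≤ ‖P‖ := le_of_sq_le_sq (h₁.trans hyP) p0.le
    have hq : ‖P - Q‖ ≤ ‖Q‖ := le_of_sq_le_sq (h₁.trans hzQ) q0.le
    have := mul_le_mul hp hq n0.le p0.le
    nlinarith [mul_pos p0 q0]
  obtain rfl : y = x - P ^ 2 := by linear_combination hP
  obtain rfl : z = x - Q ^ 2 := by linear_combination hQ
  obtain rfl : x = (P ^ 2 + Q ^ 2) / 3 := by linear_combination hs / 3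
  have g₂ : weierstrassG2 Γ' = (60 * ((P ^ 2 + Q ^ 2) / 3) ^ 2 + 16 *
      ((P ^ 2 + Q ^ 2) / 3 * ((P ^ 2 + Q ^ 2) / 3 - P ^ 2) +
        (P ^ 2 + Q ^ 2) / 3 * ((P ^ 2 + Q ^ 2) / 3 - Q ^ 2) +
        ((P ^ 2 + Q ^ 2) / 3 - P ^ 2) * ((P ^ 2 + Q ^ 2) / 3 - Q ^ 2))) / 16 := by
    rw [← hg₂]; ring
  have g₃ : weierstrassG3 Γ' = (88 * ((P ^ 2 + Q ^ 2) / 3 * ((P ^ 2 + Q ^ 2) / 3 - P ^ 2) *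
      ((P ^ 2 + Q ^ 2) / 3 - Q ^ 2)) - 56 *
      ((P ^ 2 + Q ^ 2) / 3 * ((P ^ 2 + Q ^ 2) / 3 - P ^ 2) +
        (P ^ 2 + Q ^ 2) / 3 * ((P ^ 2 + Q ^ 2) / 3 - Q ^ 2) +
        ((P ^ 2 + Q ^ 2) / 3 - P ^ 2) * ((P ^ 2 + Q ^ 2) / 3 - Q ^ 2)) *
        ((P ^ 2 + Q ^ 2) / 3)) / 64 := by
    rw [← hg₃]; ring
  let t : ℂ := (P ^ 2 + Q ^ 2) / 3
  have d₁ : (t + 2 * (P * Q)) / 4 - (t - 2 * (P * Q)) / 4 = P * Q := by ring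
  have d₂ : (t + 2 * (P * Q)) / 4 - -t / 2 = (P + Q) ^ 2 / 4 := by simp only [t]; ring
  have d₃ : (t - 2 * (P * Q)) / 4 - -t / 2 = (P - Q) ^ 2 / 4 := by simp only [t]; ring
  -- The strictly closest pair is (t - 2PQ)/4, -t/2, so the root (t + 2PQ)/4 gives the optimal
  -- subgroup.
  refine (hΓ'.1.isComplexLattice hΓ).existsUnique_isOptimalIndexTwo
    (a := (t + 2 * (P * Q)) / 4) (b := (t - 2 * (P * Q)) / 4) (c := -t / 2)
    (by rw [g₂, g₃]; ring) (by rw [g₂, g₃]; ring) (by rw [g₂, g₃]; ring)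
    (sub_ne_zero.mp ?_) (sub_ne_zero.mp ?_) (sub_ne_zero.mp ?_) ?_ ?_
  · rw [d₁]; exact mul_ne_zero hP0 hQ0
  · rw [d₂]; exact div_ne_zero (pow_ne_zero 2 hadd0) (by norm_num)
  · rw [d₃]; exact div_ne_zero (pow_ne_zero 2 hsub0) (by norm_num)
  · rw [d₁, d₃, norm_div, norm_pow, norm_mul]
    norm_num
    linarith
  · rw [d₂, d₃, norm_div, norm_div, norm_pow, norm_pow]
    have := pow_lt_pow_left₀ hlt n0.le two_ne_zero
    norm_num
    linarith
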